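/- The i.i.d. $ZS$-channel has input, state and output alphabets $\{0,1\}$ and states $S_i$ that are i.i.d. Bernoulli$(1/2)$; given input $x$ and state $s$ the output is $y=x$ if $x=s$, and is uniform on $\{0,1\}$ if $x\neq s$, independently across channel uses. The decoder sees only the outputs. A rate $R\ge 0$ is achievable if there are block codes of length $n$ with $\lceil 2^{nR}\rceil$ equiprobable messages whose average error probability tends to $0$ as $n\to\infty$; the capacity is the supremum of the achievable rates. Let $C$ be the capacity when the encoder has no state information (the codeword depends only on the message), and $C_{\mathrm{CSI\text{-}E}}$ the capacity when the encoder has causal state information (the $i$-th input is a function of the message and of the states up to and including the one of the $i$-th channel use); there is no feedback. Let $H$ be the binary entropy function and measure information in bits. Then causal state information at the encoder does not increase the capacity: $$C_{\mathrm{CSI\text{-}E}} = C = 1-H(1/4).$$ Moreover $\max I(U;Y)=\max_{P(x)} I(X;Y)=1-H(1/4)$, where the first maximum is over all finite alphabets $\mathcal U$, laws $P(u)$ of $U$ independent of the state $S$, and strategy functions $X=x(U,S)$, and in the second $X$ is independent of $S$. For every $\mathcal U$, $P(u)$ and $x(u,s)$ as above there is an input law $P(x)$, with $X$ independent of $S$,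 such that $I(X;Y)\ge I(U;Y)$. -/

import Mathlib

open Filter Topology

noncomputable section

/-- A probability mass function on a finite set. -/
abbrev IsPMF {A : Type*} [Fintype A] (p : A → ℝ) : Prop := p ∈ stdSimplex ℝ A

/-! ### Information measures, in bits -/

/-- Shannon entropy, in bits, of a probability mass function on a finite set. -/
def entropyBits {A : Type*} [Fintype A] (p : A → ℝ) : ℝ :=
  -∑ a, p a * Real.logb 2 (p a)

/-- The binary entropy function `H`, in bits. -/
def binEntropyBits (t : ℝ) : ℝ :=
  -(t * Real.logb 2 t) - (1 - t) * Real.logb 2 (1 - t)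

/-- Mutual information `I(A;B) = H(A) + H(B) - H(A,B)`, in bits, of a joint probability mass
function on `A × B`. -/
def mutualInfoBits {A B : Type*} [Fintype A] [Fintype B] (p : A × B → ℝ) : ℝ :=
  entropyBits (fun a => ∑ b, p (a, b)) + entropyBits (fun b => ∑ a, p (a, b)) - entropyBits p

/-! ### Memoryless channels with an i.i.d. state -/

/-- A discrete memoryless channel with input alphabet `X`, state alphabet `S` and output alphabet
`Y`; the states are i.i.d. with law `stateLaw`, and `trans x s y` is `P(y | x, s)`. -/
structure StateChannel (X S Y : Type) [Fintype S] [Fintype Y] where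
  stateLaw : S → ℝ
  stateLaw_isPMF : IsPMF stateLaw
  trans : X → S → Y → ℝ
  trans_isPMF : ∀ x s, IsPMF (trans x s)

/-- A block code of length `n` with `M` messages and state information available causally at the
encoder: the `i`-th input is a function of the message and of the states up to and including the
current one; the decoder sees only the outputs. -/
structure CausalCode (X S Y : Type) (n M : ℕ) where
  encode : Fin M → (i : Fin n) → ({j : Fin n // j ≤ i} → S) → X
  decode : (Fin n → Y) → Fin M

/-- A block code of length `n` with `M` messages without state information. -/
structure BlindCode (X Y : Type) (n M : ℕ) where
  encode : Fin M → Fin n → X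
  decode : (Fin n → Y) → Fin M

/-- A code without state information, as a code that ignores the state. -/
def BlindCode.toCausal {X Y : Type} (S : Type) {n M : ℕ} (c : BlindCode X Y n M) :
    CausalCode X S Y n M where
  encode m i _ := c.encode m i
  decode := c.decode

/-- The number of messages `⌈2^{nR}⌉` of a code of length `n` and rate `R`. -/
def numMessages (n : ℕ) (R : ℝ) : ℕ := ⌈(2 : ℝ) ^ ((n : ℝ) * R)⌉₊

namespace StateChannel

variable {X S Y : Type} [Fintype X] [Fintype S] [Fintype Y]

/-- The probability, given that message `m` is sent, of the state sequence `s` and the output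
sequence `y`. -/
def blockLaw (W : StateChannel X S Y) {n M : ℕ} (c : CausalCode X S Y n M) (m : Fin M)
    (s : Fin n → S) (y : Fin n → Y) : ℝ :=
  ∏ i, W.stateLaw (s i) * W.trans (c.encode m i (fun j => s j)) (s i) (y i)

open Classical in
/-- Average probability of error, for a uniformly distributed message. -/
def errorProb (W : StateChannel X S Y) {n M : ℕ} (c : CausalCode X S Y n M) : ℝ :=
  (∑ m, ∑ s, ∑ y, if c.decode y ≠ m then W.blockLaw c m s y else 0) / M

/-- Achievable rates, with state information available causally at the encoder. -/
def AchievableCausal (W : StateChannel X S Y) (R : ℝ) : Prop :=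
  0 ≤ R ∧ ∃ c : (n : ℕ) → CausalCode X S Y n (numMessages n R),
    Tendsto (fun n => W.errorProb (c n)) atTop (𝓝 0)

/-- Achievable rates, without state information. -/
def AchievableBlind (W : StateChannel X S Y) (R : ℝ) : Prop :=
  0 ≤ R ∧ ∃ c : (n : ℕ) → BlindCode X Y n (numMessages n R),
    Tendsto (fun n => W.errorProb ((c n).toCausal S)) atTop (𝓝 0)

/-- Capacity with state information available causally at the encoder only: the supremum of the
achievable rates (in the extended reals, so that the supremum always makes sense). -/
def capacityCausal (W : StateChannel X S Y) : EReal :=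
  ⨆ (R : ℝ) (_ : W.AchievableCausal R), (R : EReal)

/-- Capacity without state information at either end. -/
def capacityBlind (W : StateChannel X S Y) : EReal :=
  ⨆ (R : ℝ) (_ : W.AchievableBlind R), (R : EReal)

/-- Joint law of `(U, Y)` when `U` has law `p` and is independent of the state, and the input is
`f U S`. -/
def strategyJoint (W : StateChannel X S Y) {U : Type} (f : U → S → X) (p : U → ℝ) : U × Y → ℝ :=
  fun z => ∑ s, W.stateLaw s * p z.1 * W.trans (f z.1 s) s z.2

/-- Joint law of `(X, Y)` when the input `X` has law `q` and is independent of the state. -/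
def inputJoint (W : StateChannel X S Y) (q : X → ℝ) : X × Y → ℝ :=
  fun z => q z.1 * ∑ s, W.stateLaw s * W.trans z.1 s z.2

/-- The values `I(U;Y)` over all finite auxiliary alphabets, laws `P(u)` and functions `x(u,s)`. -/
def strategyInfos (W : StateChannel X S Y) : Set ℝ :=
  {r | ∃ (U : Type) (_ : Fintype U) (f : U → S → X) (p : U → ℝ),
    IsPMF p ∧ r = mutualInfoBits (W.strategyJoint f p)}

/-- The values `I(X;Y)` over all input laws `P(x)`, for an input independent of the state. -/
def inputInfos (W : StateChannel X S Y) : Set ℝ :=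
  {r | ∃ q : X → ℝ, IsPMF q ∧ r = mutualInfoBits (W.inputJoint q)}

end StateChannel

/-- The i.i.d. ZS channel: binary alphabets, uniform i.i.d. states; the output equals the input if
the input agrees with the state, and is a fair coin flip otherwise. (State `0` gives the Z channel
and state `1` the S channel.) -/
def zsChannel : StateChannel (Fin 2) (Fin 2) (Fin 2) where
  stateLaw _ := 1 / 2
  stateLaw_isPMF := ⟨fun _ => by norm_num, by norm_num⟩
  trans x s y := if x = s then (if y = x then 1 else 0) else 1 / 2
  trans_isPMF x s := by
    refine ⟨fun y => by dsimp only; split_ifs <;> norm_num, ?_⟩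
    by_cases h : x = s <;> simp [h]

end

/-!
Averaged over the state, the ZS channel is a binary symmetric channel with crossover probability
`1 / 4`. An encoder that sees the current state gains only two further strategies, "copy the state"
and "flip the state", and under both the output is a fair coin. So whatever the strategy, each
output value has probability at least `1 / 4`: state information can only add noise.

For the information quantities this gives `H(Y|U) ≥ H(1/4)` and hence
`I(U;Y) ≤ 1 - H(1/4)` (`mutualInfoBits_strategyJoint_le`), with equality for a uniform input that
ignores the state (`mutualInfoBits_inputJoint_uniform`).

Achievability (`achievableBlind_of_lt`) uses random codes with maximum likelihood decoding over the
group `Fin n → Fin 2` (`exists_code_additive_noise`): an error needs either noise of probability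
below `t` or a competing codeword that explains the output with probability at least `t`, and at
most `1 / t` noise words have such a probability.

The converse (`le_of_achievableCausal`) holds for every causal encoder. Given a message, the
conditional law of each output given the past outputs puts at least `1 / 4` on either value, so by
convexity the sums `∑ y, P(y) ^ (1 + ε)` are at most those of the binary symmetric channel
(`sum_causalOutput_rpow_le`). The elementary bound `x ≤ t + t ^ (-ε) * x ^ (1 + ε)` turns this into
a bound on the probability of correct decoding (`sum_decoded_le`). It tends to `0` above
`1 - H(1/4)`, so even the strong converse holds.

In both halves `t = 2 ^ (-n h)` with `h` strictly between `H(1/4)` and `1 - R`, and a small `ε > 0`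
is supplied by the derivative at `0` of an exponential moment (`exists_rpow_average_lt_one`).
-/

/-! ### Mutual information of the binary channel -/

lemma binEntropyBits_eq_binEntropy_div (t : ℝ) :
    binEntropyBits t = Real.binEntropy t / Real.log 2 := by
  simp only [binEntropyBits, Real.binEntropy, Real.logb, Real.log_inv]
  ring

lemma entropyBits_fin_two {q : Fin 2 → ℝ} (hq : ∑ y, q y = 1) :
    entropyBits q = binEntropyBits (q 0) := by
  have h1 : q 1 = 1 - q 0 := by
    rw [Fin.sum_univ_two] at hq
    linarith
  simp only [entropyBits, binEntropyBits, Fin.sum_univ_two, h1]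
  ring

lemma binEntropyBits_le_one (t : ℝ) : binEntropyBits t ≤ 1 := by
  rw [binEntropyBits_eq_binEntropy_div, div_le_one (Real.log_pos one_lt_two)]
  exact Real.binEntropy_le_log_two

lemma binEntropyBits_one_half : binEntropyBits (1 / 2) = 1 := by
  rw [binEntropyBits_eq_binEntropy_div, one_div, Real.binEntropy_two_inv]
  exact div_self (Real.log_pos one_lt_two).ne'

lemma binEntropyBits_one_quarter_lt_one : binEntropyBits (1 / 4) < 1 := by
  rw [binEntropyBits_eq_binEntropy_div, div_lt_one (Real.log_pos one_lt_two)]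
  exact Real.binEntropy_lt_log_two.2 (by norm_num)

lemma binEntropyBits_one_sub (t : ℝ) : binEntropyBits (1 - t) = binEntropyBits t := by
  simp only [binEntropyBits_eq_binEntropy_div, Real.binEntropy_one_sub]

lemma log_two_mul_binEntropyBits_one_quarter :
    Real.log 2 * binEntropyBits (1 / 4) =
      -(3 / 4 * Real.log (3 / 4) + 1 / 4 * Real.log (1 / 4)) := by
  have := (Real.log_pos one_lt_two).ne'
  rw [binEntropyBits_eq_binEntropy_div, mul_div_cancel₀ _ this]
  simp only [Real.binEntropy, Real.log_inv]
  norm_num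

/-- `I(U;Y) = H(Y) - H(Y|U)` for a joint law given by an input law and a kernel. -/
lemma mutualInfoBits_kernel {U Y : Type*} [Fintype U] [Fintype Y] (p : U → ℝ) (r : U → Y → ℝ)
    (hr : ∀ u, ∑ y, r u y = 1) :
    mutualInfoBits (fun z : U × Y => p z.1 * r z.1 z.2) =
      entropyBits (fun y => ∑ u, p u * r u y) - ∑ u, p u * entropyBits (r u) := by
  have hlog : ∀ a b : ℝ, a * b * Real.logb 2 (a * b) =
      a * Real.logb 2 a * b + a * (b * Real.logb 2 b) := by
    intro a b
    rcases eq_or_ne a 0 with rfl | ha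
    · simp
    rcases eq_or_ne b 0 with rfl | hb
    · simp
    rw [Real.logb_mul ha hb]
    ring
  have hU : ∀ u, ∑ y, p u * r u y = p u := fun u => by rw [← Finset.mul_sum, hr, mul_one]
  simp only [mutualInfoBits, hU]
  simp only [entropyBits, Fintype.sum_prod_type, hlog, Finset.sum_add_distrib, ← Finset.mul_sum,
    hr, mul_one, mul_neg, Finset.sum_neg_distrib]
  ring

/-! ### The ZS channel averaged over one state -/

/-- The noise law of the binary symmetric channel with crossover probability `1 / 4`, which is
the ZS channel averaged over its state. -/
noncomputable def bscNoise (z : Fin 2) : ℝ := if z = 0 then 3 / 4 else 1 / 4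

lemma bscNoise_pos (z : Fin 2) : 0 < bscNoise z := by
  unfold bscNoise
  split_ifs <;> norm_num

/-- The law of the output when the input is `x S`, for a strategy `x` that sees the state `S`. -/
noncomputable def zsOutput (x : Fin 2 → Fin 2) (y : Fin 2) : ℝ :=
  ∑ s, zsChannel.stateLaw s * zsChannel.trans (x s) s y

lemma sum_zsOutput (x : Fin 2 → Fin 2) : ∑ y, zsOutput x y = 1 := by
  simp only [zsOutput]
  rw [Finset.sum_comm]
  simp only [← Finset.mul_sum, (zsChannel.trans_isPMF _ _).2, mul_one]
  exact zsChannel.stateLaw_isPMF.2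

lemma zsOutput_const (x y : Fin 2) : zsOutput (fun _ => x) y = bscNoise (y - x) := by
  fin_cases x <;> fin_cases y <;> simp [zsOutput, zsChannel, bscNoise] <;> norm_num

/-- The strategies that copy or flip the state only produce a fair coin at the output; the
constant ones use the channel as a binary symmetric channel. -/
lemma zsOutput_mem (x : Fin 2 → Fin 2) (y : Fin 2) :
    zsOutput x y = 1 / 4 ∨ zsOutput x y = 1 / 2 ∨ zsOutput x y = 1 - 1 / 4 := by
  obtain ⟨a, ha⟩ : ∃ a, x 0 = a := ⟨_, rfl⟩
  obtain ⟨b, hb⟩ : ∃ b, x 1 = b := ⟨_, rfl⟩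
  simp only [zsOutput, zsChannel, Fin.sum_univ_two, ha, hb]
  fin_cases a <;> fin_cases b <;> fin_cases y <;> simp <;> norm_num

lemma one_quarter_le_zsOutput (x : Fin 2 → Fin 2) (y : Fin 2) : 1 / 4 ≤ zsOutput x y := by
  rcases zsOutput_mem x y with h | h | h <;> rw [h] <;> norm_num

lemma binEntropyBits_one_quarter_le_entropyBits_zsOutput (x : Fin 2 → Fin 2) :
    binEntropyBits (1 / 4) ≤ entropyBits (zsOutput x) := by
  rw [entropyBits_fin_two (sum_zsOutput x)]
  rcases zsOutput_mem x 0 with h | h | h <;> rw [h]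
  · rw [binEntropyBits_one_half]
    exact binEntropyBits_one_quarter_lt_one.le
  · rw [binEntropyBits_one_sub]

lemma mutualInfoBits_strategyJoint_eq {U : Type} [Fintype U] (f : U → Fin 2 → Fin 2)
    (p : U → ℝ) :
    mutualInfoBits (zsChannel.strategyJoint f p) =
      entropyBits (fun y => ∑ u, p u * zsOutput (f u) y) -
        ∑ u, p u * entropyBits (zsOutput (f u)) := by
  rw [← mutualInfoBits_kernel p (fun u => zsOutput (f u)) fun u => sum_zsOutput _]
  congr 1
  ext z
  simp only [StateChannel.strategyJoint, zsOutput, Finset.mul_sum]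
  exact Finset.sum_congr rfl fun s _ => by ring

lemma inputJoint_eq_strategyJoint (q : Fin 2 → ℝ) :
    zsChannel.inputJoint q = zsChannel.strategyJoint (fun x _ => x) q := by
  ext z
  simp only [StateChannel.strategyJoint, StateChannel.inputJoint, Finset.mul_sum]
  exact Finset.sum_congr rfl fun s _ => by ring

lemma mutualInfoBits_strategyJoint_le {U : Type} [Fintype U] (f : U → Fin 2 → Fin 2)
    {p : U → ℝ} (hp : IsPMF p) :
    mutualInfoBits (zsChannel.strategyJoint f p) ≤ 1 - binEntropyBits (1 / 4) := by
  have hY : ∑ y, ∑ u, p u * zsOutput (f u) y = 1 := by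
    rw [Finset.sum_comm]
    simp only [← Finset.mul_sum, sum_zsOutput, mul_one]
    exact hp.2
  have hrow : binEntropyBits (1 / 4) ≤ ∑ u, p u * entropyBits (zsOutput (f u)) := by
    calc binEntropyBits (1 / 4) = ∑ u, p u * binEntropyBits (1 / 4) := by
          rw [← Finset.sum_mul, hp.2, one_mul]
      _ ≤ _ := Finset.sum_le_sum fun u _ => mul_le_mul_of_nonneg_left
          (binEntropyBits_one_quarter_le_entropyBits_zsOutput _) (hp.1 u)
  rw [mutualInfoBits_strategyJoint_eq, entropyBits_fin_two hY]
  exact sub_le_sub (binEntropyBits_le_one _) hrow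

lemma isPMF_uniform_fin_two : IsPMF (fun _ : Fin 2 => (1 / 2 : ℝ)) :=
  ⟨fun _ => by norm_num, by norm_num⟩

lemma mutualInfoBits_inputJoint_uniform :
    mutualInfoBits (zsChannel.inputJoint fun _ => 1 / 2) = 1 - binEntropyBits (1 / 4) := by
  have hrow : ∀ x : Fin 2, entropyBits (zsOutput fun _ => x) = binEntropyBits (1 / 4) := by
    intro x
    rw [entropyBits_fin_two (sum_zsOutput _), zsOutput_const]
    fin_cases x
    · rw [← binEntropyBits_one_sub]
      congr 1
      norm_num [bscNoise]
    · simp [bscNoise]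
  have hY : ∀ y : Fin 2, ∑ x : Fin 2, (1 / 2 : ℝ) * zsOutput (fun _ => x) y = 1 / 2 := by
    intro y
    simp only [zsOutput_const, Fin.sum_univ_two]
    fin_cases y <;> norm_num [bscNoise]
  rw [inputJoint_eq_strategyJoint, mutualInfoBits_strategyJoint_eq]
  simp only [hrow, hY]
  rw [entropyBits_fin_two (by norm_num), binEntropyBits_one_half, Fin.sum_univ_two]
  ring

/-! ### An exponential moment below one -/

/-- The function `ε ↦ 3 / 4 * A ^ ε + 1 / 4 * B ^ ε` is `1` at `0`, with slope
`3 / 4 * log A + 1 / 4 * log B` there. -/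
lemma exists_rpow_average_lt_one {A B : ℝ} (hA : 0 < A) (hB : 0 < B)
    (h : 3 / 4 * Real.log A + 1 / 4 * Real.log B < 0) :
    ∃ ε : ℝ, 0 < ε ∧ 3 / 4 * A ^ ε + 1 / 4 * B ^ ε < 1 := by
  have hd : HasDerivAt (fun ε : ℝ => 3 / 4 * A ^ ε + 1 / 4 * B ^ ε)
      (3 / 4 * Real.log A + 1 / 4 * Real.log B) 0 := by
    have hA' := ((hasDerivAt_id (0 : ℝ)).const_rpow hA).const_mul (3 / 4)
    have hB' := ((hasDerivAt_id (0 : ℝ)).const_rpow hB).const_mul (1 / 4)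
    refine (hA'.add hB').congr_deriv ?_
    simp
  have hs := (hasDerivAt_iff_tendsto_slope.1 hd).eventually_lt_const h
  have hs' : ∀ᶠ ε in 𝓝[>] (0 : ℝ),
      slope (fun ε : ℝ => 3 / 4 * A ^ ε + 1 / 4 * B ^ ε) 0 ε < 0 :=
    hs.filter_mono (nhdsWithin_mono _ fun x (hx : 0 < x) => hx.ne')
  obtain ⟨ε, hlt, hε⟩ := (hs'.and self_mem_nhdsWithin).exists
  have hε : 0 < ε := hε
  refine ⟨ε, hε, ?_⟩
  rw [slope_def_field, div_neg_iff] at hlt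
  simp only [Real.rpow_zero, sub_zero] at hlt
  rcases hlt with h | h <;> linarith

/-- For `τ = 2 ^ (-h)` the condition of `exists_rpow_average_lt_one` reads `h < H(1/4)`. -/
lemma log_average_div_two_rpow (h : ℝ) :
    3 / 4 * Real.log (3 / 4 / 2 ^ (-h)) + 1 / 4 * Real.log (1 / 4 / 2 ^ (-h)) =
      Real.log 2 * (h - binEntropyBits (1 / 4)) := by
  have h2 : (0 : ℝ) < 2 ^ (-h) := by positivity
  rw [mul_sub, log_two_mul_binEntropyBits_one_quarter, Real.log_div (by norm_num) h2.ne',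
    Real.log_div (by norm_num) h2.ne', Real.log_rpow two_pos]
  ring

/-! ### Random coding for additive noise on a finite group -/

open Classical in
/-- Random coding with maximum likelihood decoding: for noise of law `P` on a finite abelian
group `V`, some code has average error at most `P(P(Z) < t) + (M - 1) / (|V| t)`. -/
theorem exists_code_additive_noise {V : Type*} [AddCommGroup V] [Fintype V] {P : V → ℝ}
    (hP : IsPMF P) {t : ℝ} (ht : 0 < t) {M : ℕ} (hM : 0 < M) :
    ∃ (c : Fin M → V) (d : V → Fin M),
      (∑ m, ∑ y, if d y ≠ m then P (y - c m) else 0) / M ≤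
        (∑ z, if P z < t then P z else 0) + (M - 1) / (Fintype.card V * t) := by
  have : NeZero M := ⟨hM.ne'⟩
  have hV : (0 : ℝ) < Fintype.card V := by exact_mod_cast Fintype.card_pos
  have hM' : (0 : ℝ) < M := by exact_mod_cast hM
  set T : ℝ := ∑ z, if P z < t then P z else 0 with hT
  set N : ℝ := ∑ z, if t ≤ P z then (1 : ℝ) else 0 with hN
  have hNt : N ≤ 1 / t := by
    rw [le_div_iff₀ ht, hN, Finset.sum_mul]
    refine (Finset.sum_le_sum fun z _ => ?_).trans hP.2.le
    split_ifs with h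
    · simpa using h
    · simpa using hP.1 z
  have hdec : ∀ (c : Fin M → V) (y : V), ∃ m, ∀ m', P (y - c m') ≤ P (y - c m) :=
    fun c y => Finite.exists_max fun m => P (y - c m)
  choose d hd using hdec
  have hpt : ∀ (c : Fin M → V) (m : Fin M) (y : V), (if d c y ≠ m then P (y - c m) else 0) ≤
      (if P (y - c m) < t then P (y - c m) else 0) +
        ∑ m' ∈ Finset.univ.erase m, P (y - c m) * if t ≤ P (y - c m') then 1 else 0 := by
    intro c m y
    have hterm : ∀ m', 0 ≤ P (y - c m) * if t ≤ P (y - c m') then 1 else 0 := fun m' =>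
      mul_nonneg (hP.1 _) (by split_ifs <;> norm_num)
    have hsum := Finset.sum_nonneg fun m' (_ : m' ∈ Finset.univ.erase m) => hterm m'
    by_cases hne : d c y ≠ m
    · rw [if_pos hne]
      by_cases hlt : P (y - c m) < t
      · rw [if_pos hlt]
        linarith
      · rw [if_neg hlt, zero_add]
        have hle : t ≤ P (y - c (d c y)) := (not_lt.1 hlt).trans (hd c y m)
        refine le_trans ?_ (Finset.single_le_sum (fun m' _ => hterm m')
          (Finset.mem_erase.2 ⟨hne, Finset.mem_univ (d c y)⟩))
        rw [if_pos hle, mul_one]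
    · rw [if_neg hne]
      refine add_nonneg ?_ hsum
      split_ifs
      · exact hP.1 _
      · exact le_rfl
  have hshift : ∀ (g : V → ℝ) (v : V), ∑ y, g (y - v) = ∑ y, g y := fun g v =>
    Equiv.sum_comp (Equiv.subRight v) g
  have hreflect : ∀ (g : V → ℝ) (w : V), ∑ v, g (w - v) = ∑ y, g y := fun g w =>
    Equiv.sum_comp (Equiv.subLeft w) g
  -- Translating the competing codeword by a uniform `v` leaves the law of the codebook unchanged
  -- and decouples this codeword from the received word.
  have hpair : ∀ m m' : Fin M, m' ≠ m →
      ∑ c : Fin M → V, ∑ y, P (y - c m) * (if t ≤ P (y - c m') then 1 else 0) =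
        Fintype.card (Fin M → V) * (N / Fintype.card V) := by
    intro m m' hne
    have hinv : ∀ v : V, ∑ c : Fin M → V, ∑ y, P (y - c m) * (if t ≤ P (y - c m') then 1 else 0) =
        ∑ c : Fin M → V, ∑ y, P (y - c m) * (if t ≤ P (y - c m' - v) then 1 else 0) := by
      intro v
      rw [← Equiv.sum_comp (Equiv.addRight (Pi.single m' v : Fin M → V))]
      simp only [Equiv.coe_addRight, Pi.add_apply, Pi.single_eq_same,
        Pi.single_eq_of_ne hne.symm, add_zero, sub_sub]
    have havg : Fintype.card V *
        ∑ c : Fin M → V, ∑ y, P (y - c m) * (if t ≤ P (y - c m') then 1 else 0) =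
          Fintype.card (Fin M → V) * N := by
      calc _ = ∑ v : V, ∑ c : Fin M → V, ∑ y,
            P (y - c m) * (if t ≤ P (y - c m' - v) then 1 else 0) := by
            rw [← Finset.sum_congr rfl fun v _ => hinv v, Finset.sum_const, nsmul_eq_mul,
              Finset.card_univ]
        _ = ∑ c : Fin M → V, ∑ y, ∑ v : V,
            P (y - c m) * (if t ≤ P (y - c m' - v) then 1 else 0) := by
            rw [Finset.sum_comm]
            exact Finset.sum_congr rfl fun c _ => Finset.sum_comm
        _ = ∑ c : Fin M → V, N := by
            refine Finset.sum_congr rfl fun c _ => ?_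
            simp only [← Finset.mul_sum, hreflect fun z => if t ≤ P z then (1 : ℝ) else 0]
            rw [← Finset.sum_mul, hshift P, hP.2, one_mul]
        _ = _ := by rw [Finset.sum_const, nsmul_eq_mul, Finset.card_univ]
    field_simp
    linarith
  have htotal : ∑ c : Fin M → V, (∑ m, ∑ y, if d c y ≠ m then P (y - c m) else 0) / M ≤
      ∑ c : Fin M → V, (T + (M - 1) / (Fintype.card V * t)) := by
    rw [← Finset.sum_div, div_le_iff₀ hM', Finset.sum_const, nsmul_eq_mul, Finset.card_univ]
    calc _ ≤ ∑ c : Fin M → V, ∑ m, ∑ y, ((if P (y - c m) < t then P (y - c m) else 0) +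
          ∑ m' ∈ Finset.univ.erase m, P (y - c m) * if t ≤ P (y - c m') then 1 else 0) :=
          Finset.sum_le_sum fun c _ => Finset.sum_le_sum fun m _ =>
            Finset.sum_le_sum fun y _ => hpt c m y
      _ = ∑ m : Fin M, ∑ c : Fin M → V, (T +
          ∑ m' ∈ Finset.univ.erase m, ∑ y, P (y - c m) * if t ≤ P (y - c m') then 1 else 0) := by
          rw [Finset.sum_comm]
          refine Finset.sum_congr rfl fun m _ => Finset.sum_congr rfl fun c _ => ?_
          rw [Finset.sum_add_distrib, hshift fun z => if P z < t then P z else 0,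
            Finset.sum_comm]
      _ = ∑ m : Fin M, (Fintype.card (Fin M → V) * T +
          ((M : ℝ) - 1) * (Fintype.card (Fin M → V) * (N / Fintype.card V))) := by
          refine Finset.sum_congr rfl fun m _ => ?_
          rw [Finset.sum_add_distrib, Finset.sum_const, nsmul_eq_mul, Finset.card_univ,
            Finset.sum_comm, Finset.sum_congr rfl fun m' hm' =>
              hpair m m' (Finset.ne_of_mem_erase hm'), Finset.sum_const, nsmul_eq_mul,
            Finset.card_erase_of_mem (Finset.mem_univ _), Finset.card_univ, Fintype.card_fin,
            Nat.cast_pred hM]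
      _ = Fintype.card (Fin M → V) * (T + (M - 1) * (N / Fintype.card V)) * M := by
          rw [Finset.sum_const, nsmul_eq_mul, Finset.card_univ, Fintype.card_fin]
          ring
      _ ≤ _ := by
          have hM1 : (0 : ℝ) ≤ M - 1 := by
            rw [sub_nonneg]
            exact_mod_cast hM
          have : N / Fintype.card V ≤ 1 / (Fintype.card V * t) := by
            rw [mul_comm, ← div_div]
            exact div_le_div_of_nonneg_right hNt hV.le
          rw [div_eq_mul_one_div ((M : ℝ) - 1)]
          gcongr
  obtain ⟨c, -, hc⟩ := Finset.exists_le_of_sum_le Finset.univ_nonempty htotal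
  exact ⟨c, d c, hc⟩

/-! ### Achievability without state information -/

/-- The law of `n` independent noise bits of the binary symmetric channel. -/
noncomputable def bscBlockNoise {n : ℕ} (z : Fin n → Fin 2) : ℝ := ∏ i, bscNoise (z i)

lemma bscBlockNoise_pos {n : ℕ} (z : Fin n → Fin 2) : 0 < bscBlockNoise z :=
  Finset.prod_pos fun _ _ => bscNoise_pos _

lemma sum_prod_eq_sum_pow {n : ℕ} (f : Fin 2 → ℝ) :
    ∑ z : Fin n → Fin 2, ∏ i, f (z i) = (f 0 + f 1) ^ n := by
  rw [← Fin.sum_univ_two, Fintype.sum_pow]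

lemma isPMF_bscBlockNoise (n : ℕ) : IsPMF (bscBlockNoise (n := n)) := by
  refine ⟨fun z => (bscBlockNoise_pos z).le, ?_⟩
  simp only [bscBlockNoise]
  rw [sum_prod_eq_sum_pow]
  norm_num [bscNoise]

lemma sum_blockLaw_toCausal {n M : ℕ} (c : BlindCode (Fin 2) (Fin 2) n M) (m : Fin M)
    (y : Fin n → Fin 2) :
    ∑ s, zsChannel.blockLaw (c.toCausal (Fin 2)) m s y = bscBlockNoise (y - c.encode m) := by
  simp only [StateChannel.blockLaw, BlindCode.toCausal, bscBlockNoise, Pi.sub_apply,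
    ← zsOutput_const, zsOutput]
  rw [Finset.prod_univ_sum, Fintype.piFinset_univ]

open Classical in
/-- Chernoff bound for the probability that the noise has a probability below `τ ^ n`. -/
lemma sum_bscBlockNoise_lt_le {τ ε : ℝ} (hτ : 0 < τ) (hε : 0 < ε) (n : ℕ) :
    (∑ z : Fin n → Fin 2, if bscBlockNoise z < τ ^ n then bscBlockNoise z else 0) ≤
      (3 / 4 * (τ / (3 / 4)) ^ ε + 1 / 4 * (τ / (1 / 4)) ^ ε) ^ n := by
  have hsum := sum_prod_eq_sum_pow (n := n) fun z => bscNoise z * (τ / bscNoise z) ^ ε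
  have h0 : bscNoise 0 = 3 / 4 := by simp [bscNoise]
  have h1 : bscNoise 1 = 1 / 4 := by simp [bscNoise]
  simp only [h0, h1] at hsum
  rw [← hsum]
  refine Finset.sum_le_sum fun z _ => ?_
  have hpos : ∀ i, 0 < τ / bscNoise (z i) := fun i => div_pos hτ (bscNoise_pos _)
  split_ifs with h
  · rw [Finset.prod_mul_distrib, Real.finsetProd_rpow _ _ fun i _ => (hpos i).le]
    refine le_mul_of_one_le_right (bscBlockNoise_pos z).le (Real.one_le_rpow ?_ hε.le)
    rw [Finset.prod_div_distrib, Finset.prod_const, Finset.card_univ, Fintype.card_fin]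
    exact (one_le_div (bscBlockNoise_pos z)).2 h.le
  · exact Finset.prod_nonneg fun i _ =>
      mul_nonneg (bscNoise_pos _).le (Real.rpow_nonneg (hpos i).le _)

lemma numMessages_pos (n : ℕ) (R : ℝ) : 0 < numMessages n R :=
  Nat.ceil_pos.2 (by positivity)

lemma two_rpow_le_numMessages (n : ℕ) (R : ℝ) : ((2 : ℝ) ^ R) ^ n ≤ numMessages n R := by
  rw [← Real.rpow_mul_natCast two_pos.le, mul_comm]
  exact Nat.le_ceil _

lemma numMessages_sub_one_le (n : ℕ) (R : ℝ) : (numMessages n R : ℝ) - 1 ≤ ((2 : ℝ) ^ R) ^ n := by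
  rw [← Real.rpow_mul_natCast two_pos.le, mul_comm R, sub_le_iff_le_add]
  exact (Nat.ceil_lt_add_one (by positivity)).le

/-- For `τ = 2 ^ (-h)`, the ratio of `2 ^ R` to `2 * τ` is on either side of `1` according to
whether `h < 1 - R` or `1 - R < h`. -/
lemma two_rpow_div_two_mul (R h : ℝ) : (2 : ℝ) ^ R / (2 * 2 ^ (-h)) = 2 ^ (R + h - 1) := by
  rw [Real.rpow_sub two_pos, Real.rpow_add two_pos, Real.rpow_neg two_pos.le, Real.rpow_one]
  field_simp

theorem achievableBlind_of_lt {R : ℝ} (hR0 : 0 ≤ R) (hR : R < 1 - binEntropyBits (1 / 4)) :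
    zsChannel.AchievableBlind R := by
  classical
  obtain ⟨h, hH, hh⟩ := exists_between (show binEntropyBits (1 / 4) < 1 - R by linarith)
  set τ : ℝ := 2 ^ (-h) with hτdef
  have hτ : 0 < τ := by positivity
  obtain ⟨ε, hε, hlt⟩ := exists_rpow_average_lt_one (A := τ / (3 / 4)) (B := τ / (1 / 4))
    (by positivity) (by positivity) (by
      have := log_average_div_two_rpow h
      rw [← inv_div (3 / 4 : ℝ), ← inv_div (1 / 4 : ℝ), Real.log_inv, Real.log_inv]
      have := mul_pos (Real.log_pos one_lt_two) (sub_pos.2 hH)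
      linarith)
  set g : ℝ := 3 / 4 * (τ / (3 / 4)) ^ ε + 1 / 4 * (τ / (1 / 4)) ^ ε with hg
  have hg0 : 0 ≤ g := by positivity
  have hρ : (2 : ℝ) ^ R / (2 * τ) < 1 := by
    rw [hτdef, two_rpow_div_two_mul]
    exact Real.rpow_lt_one_of_one_lt_of_neg one_lt_two (by linarith)
  refine ⟨hR0, ?_⟩
  choose c d hcd using fun n : ℕ => exists_code_additive_noise (isPMF_bscBlockNoise n)
    (pow_pos hτ n) (numMessages_pos n R)
  refine ⟨fun n => ⟨c n, d n⟩, ?_⟩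
  have herr : ∀ n, zsChannel.errorProb ((⟨c n, d n⟩ : BlindCode _ _ _ _).toCausal (Fin 2)) =
      (∑ m, ∑ y, if d n y ≠ m then bscBlockNoise (y - c n m) else 0) / numMessages n R := by
    intro n
    rw [StateChannel.errorProb]
    congr 1
    refine Finset.sum_congr rfl fun m _ => ?_
    rw [Finset.sum_comm]
    refine Finset.sum_congr rfl fun y _ => ?_
    rw [← sum_blockLaw_toCausal ⟨c n, d n⟩ m y]
    by_cases hd : d n y = m <;> simp [BlindCode.toCausal, hd]
  have hlim : Tendsto (fun n : ℕ => g ^ n + ((2 : ℝ) ^ R / (2 * τ)) ^ n) atTop (𝓝 0) := by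
    simpa using (tendsto_pow_atTop_nhds_zero_of_lt_one hg0 hlt).add
      (tendsto_pow_atTop_nhds_zero_of_lt_one (by positivity) hρ)
  refine squeeze_zero (fun n => ?_) (fun n => ?_) hlim
  · rw [herr]
    refine div_nonneg (Finset.sum_nonneg fun m _ => Finset.sum_nonneg fun y _ => ?_)
      (Nat.cast_nonneg _)
    split_ifs
    · exact (bscBlockNoise_pos _).le
    · exact le_rfl
  · rw [herr]
    refine (hcd n).trans (add_le_add (sum_bscBlockNoise_lt_le hτ hε n) ?_)
    rw [div_pow, mul_pow]
    simp only [Fintype.card_fun, Fintype.card_fin, Nat.cast_pow, Nat.cast_ofNat]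
    gcongr
    exact numMessages_sub_one_le n R

/-! ### Output laws of causal codes -/

/-- The law of the output block when the inputs are chosen by the causal encoder `e`. -/
noncomputable def causalOutput {n : ℕ} (e : (i : Fin n) → ({j : Fin n // j ≤ i} → Fin 2) → Fin 2)
    (y : Fin n → Fin 2) : ℝ :=
  ∑ s : Fin n → Fin 2, ∏ i, zsChannel.stateLaw (s i) *
    zsChannel.trans (e i fun j => s j) (s i) (y i)

/-- The restriction of a causal encoder to all channel uses but the last. -/
def causalInit {n : ℕ} {X S : Type} (e : (i : Fin (n + 1)) → ({j : Fin (n + 1) // j ≤ i} → S) → X)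
    (i : Fin n) (s : {j : Fin n // j ≤ i} → S) : X :=
  e i.castSucc fun j => s ⟨j.1.castLT (lt_of_le_of_lt (Fin.le_def.1 j.2) i.2), j.2⟩

/-- Given the earlier states, the last use of the channel is one use of a strategy that sees only
the current state. -/
lemma causalOutput_snoc {n : ℕ}
    (e : (i : Fin (n + 1)) → ({j : Fin (n + 1) // j ≤ i} → Fin 2) → Fin 2)
    (y : Fin n → Fin 2) (b : Fin 2) :
    causalOutput e (Fin.snoc y b : Fin (n + 1) → Fin 2) =
      ∑ s : Fin n → Fin 2, (∏ i, zsChannel.stateLaw (s i) *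
        zsChannel.trans (causalInit e i fun j => s j) (s i) (y i)) *
          zsOutput (fun a => e (Fin.last n) fun j => (Fin.snoc s a : Fin (n + 1) → Fin 2) j) b := by
  rw [causalOutput, ← Equiv.sum_comp (Fin.snocEquiv fun _ => Fin 2), Fintype.sum_prod_type,
    Finset.sum_comm]
  refine Finset.sum_congr rfl fun s _ => ?_
  rw [zsOutput, Finset.mul_sum]
  refine Finset.sum_congr rfl fun a _ => ?_
  rw [Fin.prod_univ_castSucc]
  simp only [Fin.snocEquiv, Equiv.coe_fn_mk, Fin.snoc_last, Fin.snoc_castSucc]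
  congr 1
  refine Finset.prod_congr rfl fun i _ => ?_
  congr 3
  funext j
  have hj : j.1.1 < n := lt_of_le_of_lt (Fin.le_def.1 j.2) i.2
  simp [Fin.snoc, hj]

lemma causalOutput_nonneg {n : ℕ}
    (e : (i : Fin n) → ({j : Fin n // j ≤ i} → Fin 2) → Fin 2) (y : Fin n → Fin 2) :
    0 ≤ causalOutput e y :=
  Finset.sum_nonneg fun _ _ => Finset.prod_nonneg fun _ _ =>
    mul_nonneg (zsChannel.stateLaw_isPMF.1 _) ((zsChannel.trans_isPMF _ _).1 _)

lemma causalOutput_snoc_zero_add_one {n : ℕ}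
    (e : (i : Fin (n + 1)) → ({j : Fin (n + 1) // j ≤ i} → Fin 2) → Fin 2) (y : Fin n → Fin 2) :
    causalOutput e (Fin.snoc y 0 : Fin (n + 1) → Fin 2) +
      causalOutput e (Fin.snoc y 1 : Fin (n + 1) → Fin 2) = causalOutput (causalInit e) y := by
  rw [causalOutput_snoc, causalOutput_snoc, ← Finset.sum_add_distrib, causalOutput]
  refine Finset.sum_congr rfl fun s _ => ?_
  rw [← mul_add, ← Fin.sum_univ_two (zsOutput _), sum_zsOutput, mul_one]

/-- Given the past outputs, either value of the next output has probability at least `1 / 4`. -/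
lemma causalOutput_init_div_four_le_snoc {n : ℕ}
    (e : (i : Fin (n + 1)) → ({j : Fin (n + 1) // j ≤ i} → Fin 2) → Fin 2)
    (y : Fin n → Fin 2) (b : Fin 2) :
    causalOutput (causalInit e) y / 4 ≤ causalOutput e (Fin.snoc y b : Fin (n + 1) → Fin 2) := by
  rw [causalOutput_snoc, causalOutput, Finset.sum_div]
  refine Finset.sum_le_sum fun s _ => ?_
  rw [div_eq_mul_one_div]
  refine mul_le_mul_of_nonneg_left (one_quarter_le_zsOutput _ _) ?_
  exact Finset.prod_nonneg fun _ _ =>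
    mul_nonneg (zsChannel.stateLaw_isPMF.1 _) ((zsChannel.trans_isPMF _ _).1 _)

lemma sum_fin_succ_eq_sum_snoc {n : ℕ} (F : (Fin (n + 1) → Fin 2) → ℝ) :
    ∑ y, F y = ∑ y : Fin n → Fin 2, (F (Fin.snoc y 0 : Fin (n + 1) → Fin 2) +
      F (Fin.snoc y 1 : Fin (n + 1) → Fin 2)) := by
  rw [← Equiv.sum_comp (Fin.snocEquiv fun _ => Fin 2), Fintype.sum_prod_type, Finset.sum_comm]
  simp only [Fin.sum_univ_two]
  rfl

lemma sum_causalOutput {n : ℕ} (e : (i : Fin n) → ({j : Fin n // j ≤ i} → Fin 2) → Fin 2) :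
    ∑ y, causalOutput e y = 1 := by
  induction n with
  | zero => simp [causalOutput]
  | succ n ih =>
    rw [sum_fin_succ_eq_sum_snoc, ← ih (causalInit e)]
    exact Finset.sum_congr rfl fun y _ => causalOutput_snoc_zero_add_one e y

/-- Among the splittings of a mass into two parts of at least a quarter each, the splitting
`3 : 1` has the largest sum of powers. -/
lemma rpow_add_rpow_le {α u v : ℝ} (hα : 1 ≤ α) (hw : 0 ≤ u + v) (hu : (u + v) / 4 ≤ u)
    (hv : (u + v) / 4 ≤ v) :
    u ^ α + v ^ α ≤ ((3 / 4) ^ α + (1 / 4) ^ α) * (u + v) ^ α := by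
  rcases hw.eq_or_lt with h0 | hpos
  · have hu0 : u = 0 := by linarith
    have hv0 : v = 0 := by linarith
    have : α ≠ 0 := by linarith
    simp [hu0, hv0, Real.zero_rpow this]
  set w := u + v with hwdef
  have hconv := (convexOn_rpow hα).2
  have hp : (3 / 4 * w : ℝ) ∈ Set.Ici 0 := Set.mem_Ici.2 (by positivity)
  have hq : (1 / 4 * w : ℝ) ∈ Set.Ici 0 := Set.mem_Ici.2 (by positivity)
  have ha : 0 ≤ 2 * u / w - 1 / 2 := by
    rw [sub_nonneg, div_le_div_iff₀ two_pos hpos]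
    linarith
  have hb : 0 ≤ 3 / 2 - 2 * u / w := by
    rw [sub_nonneg, div_le_div_iff₀ hpos two_pos]
    linarith
  have h1 := hconv hp hq ha hb (by ring)
  have h2 := hconv hq hp ha hb (by ring)
  simp only [smul_eq_mul] at h1 h2
  have e1 : (2 * u / w - 1 / 2) * (3 / 4 * w) + (3 / 2 - 2 * u / w) * (1 / 4 * w) = u := by
    field_simp
    ring
  have e2 : (2 * u / w - 1 / 2) * (1 / 4 * w) + (3 / 2 - 2 * u / w) * (3 / 4 * w) = v := by
    have : v = w - u := by rw [hwdef]; ring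
    rw [this]
    field_simp
    ring
  rw [e1] at h1
  rw [e2] at h2
  rw [add_mul, ← Real.mul_rpow (by norm_num) hpos.le, ← Real.mul_rpow (by norm_num) hpos.le]
  linarith

/-- The power sums of the output law of a causal encoder do not exceed those of the noise of the
binary symmetric channel. -/
lemma sum_causalOutput_rpow_le {α : ℝ} (hα : 1 ≤ α) {n : ℕ}
    (e : (i : Fin n) → ({j : Fin n // j ≤ i} → Fin 2) → Fin 2) :
    ∑ y, causalOutput e y ^ α ≤ ((3 / 4) ^ α + (1 / 4) ^ α) ^ n := by
  induction n with
  | zero => simp [causalOutput]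
  | succ n ih =>
    rw [sum_fin_succ_eq_sum_snoc, pow_succ']
    refine le_trans ?_ (mul_le_mul_of_nonneg_left (ih (causalInit e)) (by positivity))
    rw [Finset.mul_sum]
    refine Finset.sum_le_sum fun y _ => ?_
    have h := causalOutput_snoc_zero_add_one e y
    have h0 := causalOutput_init_div_four_le_snoc e y 0
    have h1 := causalOutput_init_div_four_le_snoc e y 1
    rw [← h] at h0 h1 ⊢
    exact rpow_add_rpow_le hα (h ▸ causalOutput_nonneg _ _) h0 h1

/-! ### Converse with causal state information -/

/-- A converse by power sums: if the output laws `O m` have power sums of order `1 + ε` at most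
`A`, then a decoder is right with total probability at most `|V| t + M t ^ (-ε) A`. -/
lemma sum_decoded_le {V : Type*} [Fintype V] {M : ℕ} {O : Fin M → V → ℝ}
    (hO : ∀ m y, 0 ≤ O m y) {ε A t : ℝ} (hε : 0 < ε) (ht : 0 < t)
    (hA : ∀ m, ∑ y, O m y ^ (1 + ε) ≤ A) (d : V → Fin M) :
    ∑ y, O (d y) y ≤ Fintype.card V * t + M * (t ^ (-ε) * A) := by
  have hpt : ∀ x : ℝ, 0 ≤ x → x ≤ t + t ^ (-ε) * x ^ (1 + ε) := by
    intro x hx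
    rcases le_total x t with h | h
    · have : 0 ≤ t ^ (-ε) * x ^ (1 + ε) := by positivity
      linarith
    · have hx' : 0 < x := ht.trans_le h
      have hle : t ^ ε ≤ x ^ ε := Real.rpow_le_rpow ht.le h hε.le
      have hx1 : x ≤ t ^ (-ε) * x ^ (1 + ε) := by
        rw [Real.rpow_neg ht.le, Real.rpow_add hx', Real.rpow_one, inv_mul_eq_div,
          le_div_iff₀ (by positivity)]
        exact mul_le_mul_of_nonneg_left hle hx
      linarith
  calc ∑ y, O (d y) y ≤ ∑ y, (t + t ^ (-ε) * ∑ m, O m y ^ (1 + ε)) := by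
        refine Finset.sum_le_sum fun y _ => (hpt _ (hO _ _)).trans ?_
        have := Finset.single_le_sum (f := fun m => O m y ^ (1 + ε))
          (fun m _ => Real.rpow_nonneg (hO m y) _) (Finset.mem_univ (d y))
        gcongr
    _ = Fintype.card V * t + t ^ (-ε) * ∑ m, ∑ y, O m y ^ (1 + ε) := by
        rw [Finset.sum_add_distrib, Finset.sum_const, nsmul_eq_mul, Finset.card_univ,
          ← Finset.mul_sum, Finset.sum_comm]
    _ ≤ Fintype.card V * t + t ^ (-ε) * ∑ m : Fin M, A := by
        gcongr with m
        exact hA m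
    _ = _ := by
        rw [Finset.sum_const, nsmul_eq_mul, Finset.card_univ, Fintype.card_fin]
        ring

lemma one_sub_errorProb {n M : ℕ} (hM : 0 < M) (c : CausalCode (Fin 2) (Fin 2) (Fin 2) n M) :
    1 - zsChannel.errorProb c = (∑ y, causalOutput (c.encode (c.decode y)) y) / M := by
  classical
  have hM' : (M : ℝ) ≠ 0 := by exact_mod_cast hM.ne'
  have hblock : ∀ m, (∑ s, ∑ y, if c.decode y ≠ m then zsChannel.blockLaw c m s y else 0) =
      1 - ∑ y, if c.decode y = m then causalOutput (c.encode m) y else 0 := by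
    intro m
    rw [Finset.sum_comm, ← sum_causalOutput (c.encode m), ← Finset.sum_sub_distrib]
    refine Finset.sum_congr rfl fun y _ => ?_
    by_cases h : c.decode y = m
    · simp [h]
    · simp [h, causalOutput, StateChannel.blockLaw]
  have herr : zsChannel.errorProb c =
      (∑ m, (1 - ∑ y, if c.decode y = m then causalOutput (c.encode m) y else 0)) / M := by
    rw [StateChannel.errorProb]
    congr 1
    refine Finset.sum_congr rfl fun m _ => ?_
    rw [← hblock m]
  rw [herr, Finset.sum_sub_distrib, Finset.sum_comm]
  simp only [Finset.sum_ite_eq, Finset.mem_univ, if_true, Finset.sum_const, Finset.card_univ,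
    Fintype.card_fin, nsmul_eq_mul, mul_one]
  field_simp
  ring

theorem le_of_achievableCausal {R : ℝ} (hR : zsChannel.AchievableCausal R) :
    R ≤ 1 - binEntropyBits (1 / 4) := by
  obtain ⟨-, c, hc⟩ := hR
  by_contra! hlt
  obtain ⟨h, hh, hH⟩ := exists_between (show 1 - R < binEntropyBits (1 / 4) by linarith)
  set τ : ℝ := 2 ^ (-h) with hτdef
  have hτ : 0 < τ := by positivity
  obtain ⟨ε, hε, hg⟩ := exists_rpow_average_lt_one (A := 3 / 4 / τ) (B := 1 / 4 / τ)
    (by positivity) (by positivity) (by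
      rw [hτdef, log_average_div_two_rpow]
      exact mul_neg_of_pos_of_neg (Real.log_pos one_lt_two) (sub_neg.2 hH))
  set g : ℝ := 3 / 4 * (3 / 4 / τ) ^ ε + 1 / 4 * (1 / 4 / τ) ^ ε with hgdef
  have hg0 : 0 ≤ g := by positivity
  have hgτ : τ ^ (-ε) * ((3 / 4) ^ (1 + ε) + (1 / 4) ^ (1 + ε)) = g := by
    rw [hgdef, Real.div_rpow (by norm_num) hτ.le, Real.div_rpow (by norm_num) hτ.le,
      Real.rpow_add (by norm_num), Real.rpow_add (by norm_num), Real.rpow_neg hτ.le,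
      Real.rpow_one, Real.rpow_one]
    ring
  have hρ : 2 * τ / 2 ^ R < 1 := by
    rw [← inv_div, hτdef, two_rpow_div_two_mul, ← Real.rpow_neg two_pos.le]
    exact Real.rpow_lt_one_of_one_lt_of_neg one_lt_two (by linarith)
  have hbound : ∀ n, 1 - zsChannel.errorProb (c n) ≤ (2 * τ / 2 ^ R) ^ n + g ^ n := by
    intro n
    have hM : (0 : ℝ) < numMessages n R := by exact_mod_cast numMessages_pos n R
    have hdec := sum_decoded_le (O := fun m => causalOutput ((c n).encode m))
      (fun m y => causalOutput_nonneg _ y) hε (pow_pos hτ n)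
      (fun m => sum_causalOutput_rpow_le (by linarith) _) (c n).decode
    have hpow : (τ ^ n) ^ (-ε) * ((3 / 4) ^ (1 + ε) + (1 / 4) ^ (1 + ε)) ^ n = g ^ n := by
      rw [← hgτ, mul_pow, ← Real.rpow_natCast_mul hτ.le, mul_comm (n : ℝ),
        Real.rpow_mul_natCast hτ.le]
    rw [hpow] at hdec
    simp only [Fintype.card_fun, Fintype.card_fin, Nat.cast_pow, Nat.cast_ofNat] at hdec
    rw [one_sub_errorProb (numMessages_pos n R), div_le_iff₀ hM]
    refine hdec.trans ?_
    rw [add_mul, ← mul_pow, mul_comm (g ^ n)]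
    gcongr
    rw [div_pow, div_mul_eq_mul_div, le_div_iff₀ (by positivity)]
    exact mul_le_mul_of_nonneg_left (two_rpow_le_numMessages n R) (by positivity)
  have hlim : Tendsto (fun n : ℕ => (2 * τ / 2 ^ R) ^ n + g ^ n) atTop (𝓝 0) := by
    simpa using (tendsto_pow_atTop_nhds_zero_of_lt_one (by positivity) hρ).add
      (tendsto_pow_atTop_nhds_zero_of_lt_one hg0 hg)
  have := le_of_tendsto_of_tendsto' (hc.const_sub 1) hlim hbound
  norm_num at this

/-! ### The capacities -/

lemma capacityBlind_le_capacityCausal : zsChannel.capacityBlind ≤ zsChannel.capacityCausal := by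
  refine iSup₂_mono' fun R hR => ⟨R, ⟨hR.1, ?_⟩, le_rfl⟩
  obtain ⟨-, c, hc⟩ := hR
  exact ⟨fun n => (c n).toCausal (Fin 2), hc⟩

lemma capacityCausal_le :
    zsChannel.capacityCausal ≤ ((1 - binEntropyBits (1 / 4) : ℝ) : EReal) :=
  iSup₂_le fun _ hR => EReal.coe_le_coe_iff.2 (le_of_achievableCausal hR)

lemma le_capacityBlind :
    ((1 - binEntropyBits (1 / 4) : ℝ) : EReal) ≤ zsChannel.capacityBlind := by
  refine EReal.ge_of_forall_gt_iff_ge.1 fun a ha => ?_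
  obtain ⟨R, hR1, hR2⟩ := exists_between
    (max_lt (EReal.coe_lt_coe_iff.1 ha) (sub_pos.2 binEntropyBits_one_quarter_lt_one))
  have hach := achievableBlind_of_lt ((le_max_right _ _).trans hR1.le) hR2
  refine le_trans (EReal.coe_le_coe_iff.2 ((le_max_left _ _).trans hR1.le)) ?_
  exact le_iSup₂ (f := fun (R : ℝ) (_ : zsChannel.AchievableBlind R) => (R : EReal)) R hach

theorem theorem8 :
    zsChannel.capacityCausal = zsChannel.capacityBlind ∧
    zsChannel.capacityBlind = ((1 - binEntropyBits (1 / 4) : ℝ) : EReal) ∧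
    IsGreatest zsChannel.strategyInfos (1 - binEntropyBits (1 / 4)) ∧
    IsGreatest zsChannel.inputInfos (1 - binEntropyBits (1 / 4)) ∧
    (∀ (U : Type) [Fintype U] (f : U → Fin 2 → Fin 2) (p : U → ℝ), IsPMF p →
      ∃ q : Fin 2 → ℝ, IsPMF q ∧
        mutualInfoBits (zsChannel.strategyJoint f p) ≤
          mutualInfoBits (zsChannel.inputJoint q)) := by
  refine ⟨le_antisymm (capacityCausal_le.trans le_capacityBlind) capacityBlind_le_capacityCausal,
    le_antisymm (capacityBlind_le_capacityCausal.trans capacityCausal_le) le_capacityBlind,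
    ⟨⟨Fin 2, inferInstance, fun x _ => x, fun _ => 1 / 2, isPMF_uniform_fin_two, ?_⟩, ?_⟩,
    ⟨⟨fun _ => 1 / 2, isPMF_uniform_fin_two, mutualInfoBits_inputJoint_uniform.symm⟩, ?_⟩,
    fun U _ f p hp => ⟨fun _ => 1 / 2, isPMF_uniform_fin_two, ?_⟩⟩
  · rw [← inputJoint_eq_strategyJoint, mutualInfoBits_inputJoint_uniform]
  · rintro r ⟨U, _, f, p, hp, rfl⟩
    exact mutualInfoBits_strategyJoint_le f hp
  · rintro r ⟨q, hq, rfl⟩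
    rw [inputJoint_eq_strategyJoint]
    exact mutualInfoBits_strategyJoint_le _ hq
  · rw [mutualInfoBits_inputJoint_uniform]
    exact mutualInfoBits_strategyJoint_le f hp
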